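/- Let $r\in(1,\infty)\setminus\{2\}$, let $R>0$ and $\xi_0\in\mathbb R$, and let $\Omega\subset\xi_0+[-R,R]$ be Lebesgue measurable. Put $K:=\mathcal F^{-1}\chi_\Omega$, i.e. $K(x)=\int_\Omega e^{2\pi i x\xi}\,d\xi$, let $(f\ast K)(x)=\int_{\mathbb R}f(y)K(x-y)\,dy$, and write $(\lambda(a)K)(x)=K(x-a)$ and $\langle f,g\rangle_{L_2}=\int_{\mathbb R} f(x)\overline{g(x)}\,dx$. Assume that $K\in L_p(\mathbb R)$ for every $p\in(1,\infty)$, and that the operator $RC_K:f\mapsto f\ast K$ is well-defined on $L_r(\mathbb R)$, i.e. for every $f\in L_r(\mathbb R)$ the function $y\mapsto f(y)K(x-y)$ is integrable for almost every $x$, and $f\ast K\in L_r(\mathbb R)$. Let $\mathcal M_r:=\{f\in L_r(\mathbb R): f\ast K=f\}$ with the $L_r$-norm. Then the family $(\lambda(k/(2R))K)_{k\in\mathbb Z}$ lies in $\mathcal M_r$ and is both a Banach frame and an atomic decomposition for $\mathcal M_r$ with coefficient space $\ell_r(\mathbb Z)$; that is, the analysis operator $f\mapsto(\langle f,\lambda(k/(2R))K\rangle_{L_2})_{k}$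 is well-defined and bounded $\mathcal M_r\to\ell_r(\mathbb Z)$ and has a bounded linear left inverse, and the synthesis operator $(c_k)_k\mapsto\sum_k c_k\,\lambda(k/(2R))K$ is well-defined (with unconditional convergence in $\mathcal M_r$) and bounded $\ell_r(\mathbb Z)\to\mathcal M_r$ and has a bounded linear right inverse. More precisely, every $f\in\mathcal M_r$ has a (unique) continuous representative, again denoted $f$, the operators $$\mathrm{Samp}:\mathcal M_r\to\ell_r(\mathbb Z),\quad f\mapsto\big(f(k/(2R))\big)_{k\in\mathbb Z}=\big(\langle f,\lambda(k/(2R))K\rangle_{L_2}\big)_{k\in\mathbb Z},$$ $$\mathrm{Synth}:\ell_r(\mathbb Z)\to\mathcal M_r,\quad (c_k)_{k\in\mathbb Z}\mapsto\sum_{k\in\mathbb Z}c_k\,\lambda(k/(2R))K$$ are well-defined, linear and bounded, and $\mathrm{Synth}\circ\mathrm{Samp}=2R\cdot\mathrm{id}_{\mathcal M_r}$. -/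

import Mathlib

open MeasureTheory Filter
open scoped ENNReal FourierTransform ComplexConjugate Convolution

noncomputable section

/-- The kernel `K = 𝓕⁻¹ χ_Ω`, that is `K x = ∫_Ω exp (2 π i x ξ) dξ`. -/
def bandKernel (Ω : Set ℝ) : ℝ → ℂ :=
  𝓕⁻ (Ω.indicator (fun _ => (1 : ℂ)))

/-- Left translation `(λ(a) F)(x) = F (x - a)` on functions on the real line. -/
def leftTranslate (a : ℝ) (F : ℝ → ℂ) : ℝ → ℂ := fun x => F (x - a)

/-- The convolution `(f ∗ g)(x) = ∫ f(y) g(x - y) dy`. -/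
def conv (f g : ℝ → ℂ) : ℝ → ℂ := f ⋆[ContinuousLinearMap.mul ℂ ℂ, volume] g

/-- `f` and `g` are convolvable: for almost every `x`, the function `y ↦ f(y) g(x - y)` is
integrable. -/
def Convolvable (f g : ℝ → ℂ) : Prop :=
  ∀ᵐ x : ℝ, ConvolutionExistsAt f g x (ContinuousLinearMap.mul ℂ ℂ) volume

/-- The sesquilinear pairing `⟨f, g⟩ = ∫ f(x) conj (g(x)) dx`; it is meaningful when
`f * conj g` is integrable. -/
def pairingL2 (f g : ℝ → ℂ) : ℂ := ∫ x : ℝ, f x * conj (g x)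

/-- The right convolution operator `f ↦ f ∗ K` is well-defined as a map from `L_r(ℝ)` to itself. -/
def RightConvolutionWellDefined (r : ℝ≥0∞) (K : ℝ → ℂ) : Prop :=
  ∀ f : ℝ → ℂ, MemLp f r volume → Convolvable f K ∧ MemLp (conv f K) r volume

lemma Convolvable.congr_left {f f' g : ℝ → ℂ} (h : f =ᵐ[volume] f') (hf : Convolvable f g) :
    Convolvable f' g := by
  filter_upwards [hf] with x hx
  refine Integrable.congr hx ?_
  filter_upwards [h] with y hy
  simp [hy]

lemma conv_congr_left {f f' g : ℝ → ℂ} (h : f =ᵐ[volume] f') : conv f g = conv f' g := by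
  funext x
  refine integral_congr_ae ?_
  filter_upwards [h] with y hy
  simp [hy]

/-- The reproducing kernel space `{f ∈ L_r(ℝ) | f ∗ K = f}` with the norm of `L_r(ℝ)`. -/
def reproducingSpace (r : ℝ≥0∞) (K : ℝ → ℂ) : Submodule ℂ (Lp ℂ r (volume : Measure ℝ)) where
  carrier := {f | Convolvable f K ∧ conv f K =ᵐ[volume] f}
  add_mem' := by
    rintro f g ⟨hf, hf'⟩ ⟨hg, hg'⟩
    have e : (⇑f + ⇑g : ℝ → ℂ) =ᵐ[volume] ⇑(f + g) := (Lp.coeFn_add f g).symm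
    refine ⟨Convolvable.congr_left e ?_, ?_⟩
    · filter_upwards [hf, hg] with x hx hy
      refine (Integrable.add hx hy).congr (ae_of_all _ fun y => ?_)
      simp [add_mul]
    · rw [← conv_congr_left e]
      filter_upwards [hf, hg, hf', hg', e] with x hx hy hx' hy' he
      rw [← he, Pi.add_apply, ← hx', ← hy']
      exact hx.add_distrib hy
  zero_mem' := by
    have e : (0 : ℝ → ℂ) =ᵐ[volume] ⇑(0 : Lp ℂ r (volume : Measure ℝ)) :=
      (Lp.coeFn_zero ℂ r volume).symm
    refine ⟨Convolvable.congr_left e ?_, ?_⟩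
    · refine ae_of_all _ fun x => ?_
      simp [ConvolutionExistsAt]
    · rw [← conv_congr_left e]
      filter_upwards [e] with x he
      rw [← he]
      simp [conv]
  smul_mem' := by
    rintro c f ⟨hf, hf'⟩
    have e : (c • ⇑f : ℝ → ℂ) =ᵐ[volume] ⇑(c • f) := (Lp.coeFn_smul c f).symm
    refine ⟨Convolvable.congr_left e ?_, ?_⟩
    · filter_upwards [hf] with x hx
      refine (Integrable.smul c hx).congr (ae_of_all _ fun y => ?_)
      simp [mul_assoc]
    · rw [← conv_congr_left e]
      filter_upwards [hf', e] with x hx he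
      rw [← he, Pi.smul_apply, ← hx]
      simp [conv, smul_convolution]

/-- The coefficient space `ℓ_r(ι)`. -/
abbrev coeffSpace (ι : Type*) (r : ℝ≥0∞) : Type _ := lp (fun _ : ι => ℂ) r

/-- The family of functionals `φ` is a Banach frame for `E` with coefficient space `ℓ_r(ι)`: the
analysis operator `f ↦ (φ i f)_i` is a well-defined bounded linear operator from `E` to `ℓ_r(ι)`
and has a bounded linear left inverse. -/
def IsBanachFrame {ι E : Type*} [NormedAddCommGroup E] [NormedSpace ℂ E]
    (r : ℝ≥0∞) [Fact (1 ≤ r)] (φ : ι → E → ℂ) : Prop :=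
  ∃ A : E →L[ℂ] coeffSpace ι r, (∀ f i, A f i = φ i f) ∧
    ∃ B : coeffSpace ι r →L[ℂ] E, B ∘L A = ContinuousLinearMap.id ℂ E

/-- The family `a` is an atomic decomposition (a family of atoms) for `E` with coefficient space
`ℓ_r(ι)`: the synthesis operator `c ↦ ∑ i, c i • a i`, with unconditional convergence in `E`,
is a well-defined bounded linear operator from `ℓ_r(ι)` to `E` and has a bounded linear right
inverse. -/
def IsAtomicDecomposition {ι E : Type*} [NormedAddCommGroup E] [NormedSpace ℂ E]
    (r : ℝ≥0∞) [Fact (1 ≤ r)] (a : ι → E) : Prop :=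
  ∃ S : coeffSpace ι r →L[ℂ] E, (∀ c, HasSum (fun i => c i • a i) (S c)) ∧
    ∃ C : E →L[ℂ] coeffSpace ι r, S ∘L C = ContinuousLinearMap.id ℂ E

end

/-! Parseval on `[ξ₀ - R, ξ₀ + R]`, applied to exponentials cut off to `Ω`, gives `∑ₖ K(k/2R - y)
K(x - k/2R) = 2R · K(x - y)` (`hasSum_bandKernel_mul`). Integrating against an integrable `h` yields
the sampling formula for `h ∗ K` (`hasSum_conv_bandKernel`); integrating over one period yields `K ∗
K = K`.

Boundedness cannot come from absolute estimates on `K`, which need not be integrable. Instead choose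
a Schwartz `φ` with `φ ∗ K = K`. On the reproducing space `f ∗ K = f ∗ φ`, so sampling there is
sampling of `f ∗ φ`; synthesis from translates of `K` is synthesis from translates of `φ` followed
by `f ↦ f ∗ K`. The `φ` operators are bounded by the Schur test, and `f ↦ f ∗ K` is bounded by the
closed graph theorem.

The map `P : f ↦ f ∗ K` is a projection of `L_r` onto the reproducing space. The identity `Synth
(Samp (P h)) = 2R • P h` holds for integrable `h`, extends to `L_r` by density, and gives the
theorem because `P` fixes the space. -/

theorem HasSum.of_eq {ι M : Type*} [AddCommMonoid M] [TopologicalSpace M] {f g : ι → M} {a b : M}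
    (hf : HasSum f a) (h : ∀ i, g i = f i) (hab : b = a) : HasSum g b := by
  rwa [funext h, hab]

/-- Parseval in `L²` of the circle of length `b - a`; the factor `(b - a)⁻¹` is the normalization of
Haar measure. -/
theorem hasSum_conj_fourierCoeffOn_mul {a b : ℝ} (hab : a < b) {u v : ℝ → ℂ}
    (hu : MemLp u 2 (volume.restrict (Set.Ioc a b)))
    (hv : MemLp v 2 (volume.restrict (Set.Ioc a b))) :
    HasSum (fun n : ℤ => conj (fourierCoeffOn hab u n) * fourierCoeffOn hab v n)
      (((b - a)⁻¹ : ℝ) * ∫ x in a..b, conj (u x) * v x) := by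
  have hT : Fact (0 < b - a) := ⟨by linarith⟩
  rw [← add_sub_cancel a b] at hu hv
  have hu' := hu.memLp_liftIoc.haarAddCircle
  have hv' := hv.memLp_liftIoc.haarAddCircle
  have key := fourierBasis.hasSum_inner_mul_inner hu'.toLp hv'.toLp
  refine key.of_eq (fun n => ?_) ?_
  · rw [← HilbertBasis.repr_apply_apply, fourierBasis_repr, ← inner_conj_symm,
      ← HilbertBasis.repr_apply_apply, fourierBasis_repr,
      fourierCoeff_congr_ae hu'.coeFn_toLp, fourierCoeff_congr_ae hv'.coeFn_toLp]
    rfl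
  · rw [L2.inner_def]
    have : ∀ᵐ x ∂(@AddCircle.haarAddCircle (b - a) hT), inner ℂ (hu'.toLp _ x) (hv'.toLp _ x)
        = AddCircle.liftIoc (b - a) a (fun x => conj (u x) * v x) x := by
      filter_upwards [hu'.coeFn_toLp, hv'.coeFn_toLp] with x h1 h2
      rw [h1, h2, RCLike.inner_apply', ]
      rfl
    rw [integral_congr_ae this, AddCircle.integral_haarAddCircle,
      AddCircle.integral_liftIoc_eq_intervalIntegral, add_sub_cancel, Complex.real_smul]

/-! ### Sampling identities for the kernel at the Nyquist rate. -/

section Kernel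

variable {Ω : Set ℝ}

theorem norm_cexp_two_pi_mul_I (x ξ : ℝ) :
    ‖Complex.exp (2 * Real.pi * x * ξ * Complex.I)‖ = 1 := by
  rw [show (2 * Real.pi * x * ξ * Complex.I : ℂ) = ((2 * Real.pi * x * ξ : ℝ) : ℂ) * Complex.I by
    push_cast; ring, Complex.norm_exp_ofReal_mul_I]

theorem bandKernel_apply (hΩ : MeasurableSet Ω) (x : ℝ) :
    bandKernel Ω x = ∫ ξ in Ω, Complex.exp (2 * Real.pi * x * ξ * Complex.I) := by
  rw [bandKernel, Real.fourierInv_eq', ← integral_indicator hΩ]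
  congr 1; funext ξ
  by_cases h : ξ ∈ Ω
  · simp [h]; ring_nf
  · simp [h]

theorem bandKernel_neg (hΩ : MeasurableSet Ω) (x : ℝ) :
    bandKernel Ω (-x) = conj (bandKernel Ω x) := by
  rw [bandKernel_apply hΩ, bandKernel_apply hΩ, ← integral_conj]
  congr 1; funext ξ
  rw [← Complex.exp_conj]
  simp [Complex.conj_ofNat]

theorem continuous_bandKernel (hΩ : MeasurableSet Ω) (hfin : volume Ω ≠ ∞) :
    Continuous (bandKernel Ω) := by
  have : bandKernel Ω = fun x : ℝ => ∫ ξ in Ω, Complex.exp (2 * Real.pi * x * ξ * Complex.I) :=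
    funext (bandKernel_apply hΩ)
  rw [this]
  have : IsFiniteMeasure (volume.restrict Ω) := ⟨by simpa using hfin.lt_top⟩
  refine continuous_of_dominated (bound := fun _ => 1) ?_ ?_ (integrable_const _) ?_
  · intro x; exact (by fun_prop : Continuous _).aestronglyMeasurable
  · exact fun x => ae_of_all _ fun ξ => (norm_cexp_two_pi_mul_I x ξ).le
  · exact ae_of_all _ fun ξ => by fun_prop

/-- Parseval's identity for the samples of two translates of the kernel at the Nyquist rate. -/
theorem hasSum_bandKernel_mul (hΩ : MeasurableSet Ω) {R ξ₀ : ℝ} (hR : 0 < R)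
    (hΩR : Ω ⊆ Set.Icc (ξ₀ - R) (ξ₀ + R)) (x y : ℝ) :
    HasSum (fun k : ℤ => bandKernel Ω (k / (2 * R) - y) * bandKernel Ω (x - k / (2 * R)))
      (2 * R * bandKernel Ω (x - y)) := by
  have hab : ξ₀ - R < ξ₀ + R := by linarith
  -- The `n`-th Fourier coefficient of `u z` is `K(z - n/2R) / 2R`, so samples of `K` are Fourier
  -- coefficients.
  set u : ℝ → ℝ → ℂ := fun z => Ω.indicator fun ξ =>
    Complex.exp (2 * Real.pi * z * ξ * Complex.I) with hu
  have hmem : ∀ z, MemLp (u z) 2 (volume.restrict (Set.Ioc (ξ₀ - R) (ξ₀ + R))) := by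
    intro z
    refine MemLp.of_bound (C := 1) ?_ ?_
    · exact ((by fun_prop : Continuous fun ξ : ℝ =>
        Complex.exp (2 * Real.pi * z * ξ * Complex.I)).measurable.indicator hΩ).aestronglyMeasurable
    · refine ae_of_all _ fun ξ => ?_
      by_cases h : ξ ∈ Ω
      · simp only [hu, Set.indicator_of_mem h, norm_cexp_two_pi_mul_I, le_refl]
      · simp [hu, h]
  have hint : ∀ z, ∫ ξ in (ξ₀ - R)..(ξ₀ + R), u z ξ = bandKernel Ω z := by
    intro z
    rw [intervalIntegral.integral_of_le hab.le, ← integral_Icc_eq_integral_Ioc,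
      bandKernel_apply hΩ, hu, setIntegral_indicator hΩ, Set.inter_eq_right.mpr hΩR]
  have hmul : ∀ z w ξ, conj (u z ξ) * u w ξ = u (w - z) ξ := by
    intro z w ξ
    by_cases h : ξ ∈ Ω
    · simp only [hu, Set.indicator_of_mem h]
      rw [← Complex.exp_conj, ← Complex.exp_add]
      congr 1
      simp [Complex.conj_ofNat]
      ring
    · simp [hu, h]
  have hcoef : ∀ (z : ℝ) (n : ℤ), fourierCoeffOn hab (u z) n
      = ((2 * R)⁻¹ : ℝ) * bandKernel Ω (z - n / (2 * R)) := by
    intro z n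
    rw [fourierCoeffOn_eq_integral, ← hint, Complex.real_smul]
    congr 1
    · congr 1; rw [one_div]; congr 1; ring
    · congr 1; funext ξ
      by_cases h : ξ ∈ Ω
      · simp only [hu, Set.indicator_of_mem h, fourier_coe_apply, smul_eq_mul]
        rw [← Complex.exp_add]
        congr 1
        have : (R : ℂ) ≠ 0 := by exact_mod_cast hR.ne'
        push_cast
        rw [show (ξ₀ + R - (ξ₀ - R) : ℂ) = 2 * R by ring]
        field_simp
        ring
      · simp [hu, h]
  -- The factor `(2R)²` clears the normalization of the two coefficients.
  have key := (hasSum_conj_fourierCoeffOn_mul hab (hmem y) (hmem x)).mul_left ((2 * R : ℂ) ^ 2)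
  simp only [hmul, hint, hcoef] at key
  have hR' : (R : ℂ) ≠ 0 := by exact_mod_cast hR.ne'
  refine key.of_eq (fun k => ?_) ?_
  · rw [map_mul, ← bandKernel_neg hΩ, neg_sub, Complex.conj_ofReal]
    push_cast
    field_simp
  · rw [show ξ₀ + R - (ξ₀ - R) = 2 * R by ring]
    push_cast
    field_simp

theorem hasSum_norm_sq_bandKernel (hΩ : MeasurableSet Ω) {R ξ₀ : ℝ} (hR : 0 < R)
    (hΩR : Ω ⊆ Set.Icc (ξ₀ - R) (ξ₀ + R)) (x : ℝ) :
    HasSum (fun k : ℤ => ‖bandKernel Ω (x - k / (2 * R))‖ ^ 2)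
      (2 * R * (bandKernel Ω 0).re) := by
  have := Complex.hasSum_re (hasSum_bandKernel_mul hΩ hR hΩR x x)
  refine this.of_eq (fun k => ?_) ?_
  · rw [← neg_sub x, bandKernel_neg hΩ, ← Complex.normSq_eq_conj_mul_self, Complex.ofReal_re,
      Complex.normSq_eq_norm_sq]
  · rw [sub_self]
    rw [show (2 * R : ℂ) = ((2 * R : ℝ) : ℂ) by push_cast; ring, Complex.re_ofReal_mul]

/-- By AM-GM. The point of this majorant is that its sum over `k` does not depend on `x` or `y`, so
it serves in every dominated convergence argument below. -/
theorem norm_bandKernel_mul_le (hΩ : MeasurableSet Ω) (R x y : ℝ) (k : ℤ) :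
    ‖bandKernel Ω (k / (2 * R) - y) * bandKernel Ω (x - k / (2 * R))‖ ≤
      2⁻¹ * (‖bandKernel Ω (y - k / (2 * R))‖ ^ 2 + ‖bandKernel Ω (x - k / (2 * R))‖ ^ 2) := by
  rw [← neg_sub y, bandKernel_neg hΩ, norm_mul, RCLike.norm_conj]
  nlinarith [sq_nonneg (‖bandKernel Ω (y - k / (2 * R))‖ - ‖bandKernel Ω (x - k / (2 * R))‖)]

theorem hasSum_bandKernel_majorant (hΩ : MeasurableSet Ω) {R ξ₀ : ℝ} (hR : 0 < R)
    (hΩR : Ω ⊆ Set.Icc (ξ₀ - R) (ξ₀ + R)) (x y : ℝ) :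
    HasSum (fun k : ℤ => 2⁻¹ *
      (‖bandKernel Ω (y - k / (2 * R))‖ ^ 2 + ‖bandKernel Ω (x - k / (2 * R))‖ ^ 2))
      (2 * R * (bandKernel Ω 0).re) := by
  refine (((hasSum_norm_sq_bandKernel hΩ hR hΩR y).add
    (hasSum_norm_sq_bandKernel hΩ hR hΩR x)).mul_left 2⁻¹).of_eq (fun _ => rfl) ?_
  ring

theorem conv_apply (f g : ℝ → ℂ) (x : ℝ) : conv f g x = ∫ y, f y * g (x - y) := rfl

/-- Sampling at the Nyquist rate reproduces convolution products `h ∗ K` with `h` integrable. -/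
theorem hasSum_conv_bandKernel (hΩ : MeasurableSet Ω) {R ξ₀ : ℝ} (hR : 0 < R)
    (hΩR : Ω ⊆ Set.Icc (ξ₀ - R) (ξ₀ + R)) {h : ℝ → ℂ} (hh : Integrable h) (x : ℝ) :
    HasSum (fun k : ℤ => conv h (bandKernel Ω) (k / (2 * R)) * bandKernel Ω (x - k / (2 * R)))
      (2 * R * conv h (bandKernel Ω) x) := by
  have hfin : volume Ω ≠ ∞ := ((measure_mono hΩR).trans_lt measure_Icc_lt_top).ne
  have hcont := continuous_bandKernel hΩ hfin
  have key := hasSum_integral_of_dominated_convergence (μ := volume)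
    (F := fun (k : ℤ) y => h y * (bandKernel Ω (k / (2 * R) - y) * bandKernel Ω (x - k / (2 * R))))
    (f := fun y => h y * (2 * R * bandKernel Ω (x - y)))
    (fun k y => ‖h y‖ * (2⁻¹ *
      (‖bandKernel Ω (y - k / (2 * R))‖ ^ 2 + ‖bandKernel Ω (x - k / (2 * R))‖ ^ 2)))
    (fun k => hh.1.mul (by fun_prop : Continuous _).aestronglyMeasurable)
    (fun k => ae_of_all _ fun y => by
      rw [norm_mul]; gcongr; exact norm_bandKernel_mul_le hΩ R x y k)
    (ae_of_all _ fun y => ((hasSum_bandKernel_majorant hΩ hR hΩR x y).mul_left _).summable)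
    (by
      simp_rw [fun y => ((hasSum_bandKernel_majorant hΩ hR hΩR x y).mul_left ‖h y‖).tsum_eq]
      exact hh.norm.mul_const _)
    (ae_of_all _ fun y => (hasSum_bandKernel_mul hΩ hR hΩR x y).mul_left _)
  refine key.of_eq (fun k => ?_) ?_
  · rw [conv_apply, ← integral_mul_const]
    simp only [mul_assoc]
  · rw [conv_apply, ← integral_const_mul]
    congr 1; funext y; ring

/-- The kernel `K` is idempotent: `K ∗ K = K`. -/
theorem conv_bandKernel_self (hΩ : MeasurableSet Ω) {R ξ₀ : ℝ} (hR : 0 < R)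
    (hΩR : Ω ⊆ Set.Icc (ξ₀ - R) (ξ₀ + R)) (hK : MemLp (bandKernel Ω) 2 volume) :
    conv (bandKernel Ω) (bandKernel Ω) = bandKernel Ω := by
  funext x
  have hfin : volume Ω ≠ ∞ := ((measure_mono hΩR).trans_lt measure_Icc_lt_top).ne
  have hcont := continuous_bandKernel hΩ hfin
  have hR0 : 2 * R ≠ 0 := by positivity
  set F : ℝ → ℂ := fun y => bandKernel Ω y * bandKernel Ω (x - y) with hF
  have hint : Integrable F :=
    hK.integrable_mul (hK.comp_measurePreserving (Measure.measurePreserving_sub_left volume x))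
  -- After rescaling by `2R`, the integral of `F` splits into unit cells. By Parseval the sum over
  -- cells is the constant `2R · K x` for each offset `t`, so integrating over `t` in `[0, 1]`
  -- evaluates it.
  have h1 := (hint.comp_div hR0).hasSum_intervalIntegral_comp_add_int
  have h2 := intervalIntegral.hasSum_integral_of_dominated_convergence (μ := volume) (a := 0)
    (b := 1) (F := fun (n : ℤ) t => F ((t + n) / (2 * R)))
    (f := fun _ => 2 * R * bandKernel Ω x)
    (fun k t => 2⁻¹ * (‖bandKernel Ω (- (t / (2 * R)) - k / (2 * R))‖ ^ 2
      + ‖bandKernel Ω ((x - t / (2 * R)) - k / (2 * R))‖ ^ 2))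
    (fun k => (by fun_prop : Continuous _).aestronglyMeasurable)
    (fun k => ae_of_all _ fun t _ => by
      refine le_of_eq_of_le ?_
        (norm_bandKernel_mul_le hΩ R (x - t / (2 * R)) (- (t / (2 * R))) k)
      simp only [hF]; congr 3 <;> ring)
    (ae_of_all _ fun y _ => (hasSum_bandKernel_majorant hΩ hR hΩR _ _).summable)
    (by
      refine (intervalIntegrable_const (c := 2 * R * (bandKernel Ω 0).re)).congr
        (fun t _ => ?_)
      exact ((hasSum_bandKernel_majorant hΩ hR hΩR (x - t / (2 * R))
        (- (t / (2 * R)))).tsum_eq).symm)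
    (ae_of_all _ fun t _ => by
      refine (hasSum_bandKernel_mul hΩ hR hΩR (x - t / (2 * R)) (- (t / (2 * R)))).of_eq
        (fun k => ?_) ?_
      · simp only [hF]; congr 2 <;> ring
      · congr 2; ring)
  have h3 := h1.unique h2
  rw [Measure.integral_comp_div, intervalIntegral.integral_const] at h3
  rw [conv_apply]
  have hR' : (R : ℂ) ≠ 0 := by exact_mod_cast hR.ne'
  rw [abs_of_pos (by positivity), Complex.real_smul] at h3
  simp at h3
  exact h3.resolve_right hR.ne'

end Kernel

/-! ### The Schur test. -/

/-- Hölder for the splitting `k = k^(1/r) · k^(1/q)` with `q` conjugate to `r`. -/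
theorem rpow_lintegral_mul_le {β : Type*} [MeasurableSpace β] {ν : Measure β} {k u : β → ℝ≥0∞}
    (hk : AEMeasurable k ν) (hu : AEMeasurable u ν) {r : ℝ} (hr : 1 < r) :
    (∫⁻ y, k y * u y ∂ν) ^ r ≤ (∫⁻ y, k y ∂ν) ^ (r - 1) * ∫⁻ y, k y * u y ^ r ∂ν := by
  have hr0 : 0 < r := by linarith
  have hpq : r.HolderConjugate r.conjExponent := Real.HolderConjugate.conjExponent hr
  set q := r.conjExponent
  have hq0 : 0 < q := hpq.symm.pos
  have H := ENNReal.lintegral_mul_le_Lp_mul_Lq ν hpq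
    (f := fun y => k y ^ (1 / r) * u y) (g := fun y => k y ^ (1 / q))
    ((hk.pow_const _).mul hu) (hk.pow_const _)
  have e1 : ∀ y, ((fun y => k y ^ (1 / r) * u y) * fun y => k y ^ (1 / q)) y = k y * u y := by
    intro y
    simp only [Pi.mul_apply]
    rw [mul_right_comm, ← ENNReal.rpow_add_of_nonneg _ _ (by positivity) (by positivity)]
    rw [one_div, one_div, hpq.inv_add_inv_eq_one, ENNReal.rpow_one]
  have e2 : ∀ y, (k y ^ (1 / r) * u y) ^ r = k y * u y ^ r := by
    intro y
    rw [ENNReal.mul_rpow_of_nonneg _ _ hr0.le, ← ENNReal.rpow_mul, one_div_mul_cancel hr0.ne',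
      ENNReal.rpow_one]
  have e3 : ∀ y, (k y ^ (1 / q)) ^ q = k y := by
    intro y
    rw [← ENNReal.rpow_mul, one_div_mul_cancel hq0.ne', ENNReal.rpow_one]
  simp only [e1, e2, e3] at H
  calc (∫⁻ y, k y * u y ∂ν) ^ r
      ≤ ((∫⁻ y, k y * u y ^ r ∂ν) ^ (1 / r) * (∫⁻ y, k y ∂ν) ^ (1 / q)) ^ r := by gcongr
    _ = _ := by
      rw [ENNReal.mul_rpow_of_nonneg _ _ hr0.le, ← ENNReal.rpow_mul, ← ENNReal.rpow_mul,
        one_div_mul_cancel hr0.ne', ENNReal.rpow_one, mul_comm]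
      congr 2
      simp only [q, Real.conjExponent]
      field_simp

/-- The **Schur test** on `L^r`. -/
theorem lintegral_rpow_lintegral_mul_le {α β : Type*} [MeasurableSpace α] [MeasurableSpace β]
    {μ : Measure α} {ν : Measure β} [SFinite μ] [SFinite ν] {k : α → β → ℝ≥0∞}
    (hk : Measurable (Function.uncurry k)) {u : β → ℝ≥0∞} (hu : AEMeasurable u ν) {r : ℝ}
    (hr : 1 < r) {A B : ℝ≥0∞} (hA : ∀ x, ∫⁻ y, k x y ∂ν ≤ A) (hB : ∀ y, ∫⁻ x, k x y ∂μ ≤ B) :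
    ∫⁻ x, (∫⁻ y, k x y * u y ∂ν) ^ r ∂μ ≤ A ^ (r - 1) * B * ∫⁻ y, u y ^ r ∂ν := by
  have hmeas : AEMeasurable (Function.uncurry fun x y => k x y * u y ^ r) (μ.prod ν) :=
    hk.aemeasurable.mul (hu.comp_snd.pow_const r)
  calc ∫⁻ x, (∫⁻ y, k x y * u y ∂ν) ^ r ∂μ
      ≤ ∫⁻ x, A ^ (r - 1) * ∫⁻ y, k x y * u y ^ r ∂ν ∂μ := by
        refine lintegral_mono fun x => ?_
        refine (rpow_lintegral_mul_le hk.of_uncurry_left.aemeasurable hu hr).trans ?_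
        gcongr
        exact hA x
    _ = A ^ (r - 1) * ∫⁻ y, ∫⁻ x, k x y * u y ^ r ∂μ ∂ν := by
        rw [← lintegral_lintegral_swap hmeas]
        exact lintegral_const_mul'' _ hmeas.lintegral_prod_right'
    _ = A ^ (r - 1) * ∫⁻ y, (∫⁻ x, k x y ∂μ) * u y ^ r ∂ν := by
        congr 2; funext y
        rw [lintegral_mul_const _ hk.of_uncurry_right]
    _ ≤ A ^ (r - 1) * ∫⁻ y, B * u y ^ r ∂ν := by
        gcongr with y
        exact hB y
    _ = _ := by
        rw [lintegral_const_mul'' _ (hu.pow_const r), mul_assoc]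

theorem exists_lintegral_rpow_lintegral_mul_le {α β : Type*} [MeasurableSpace α]
    [MeasurableSpace β] (μ : Measure α) (ν : Measure β) [SFinite μ] [SFinite ν]
    {k : α → β → ℝ≥0∞} (hk : Measurable (Function.uncurry k)) {r : ℝ} (hr : 1 < r)
    (hA : ∃ A : ℝ≥0∞, A ≠ ∞ ∧ ∀ x, ∫⁻ y, k x y ∂ν ≤ A)
    (hB : ∃ B : ℝ≥0∞, B ≠ ∞ ∧ ∀ y, ∫⁻ x, k x y ∂μ ≤ B) :
    ∃ M : ℝ, 0 ≤ M ∧ ∀ u : β → ℝ≥0∞, AEMeasurable u ν → ∀ D : ℝ, 0 ≤ D →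
      ∫⁻ y, u y ^ r ∂ν ≤ ENNReal.ofReal (D ^ r) →
      ∫⁻ x, (∫⁻ y, k x y * u y ∂ν) ^ r ∂μ ≤ ENNReal.ofReal ((M * D) ^ r) := by
  obtain ⟨A, hA', hA⟩ := hA
  obtain ⟨B, hB', hB⟩ := hB
  have hr0 : 0 < r := by linarith
  have hfin : A ^ (r - 1) * B ≠ ∞ :=
    ENNReal.mul_ne_top (ENNReal.rpow_ne_top_of_nonneg (by linarith) hA') hB'
  refine ⟨(A ^ (r - 1) * B).toReal ^ r⁻¹, by positivity, fun u hu D hD h => ?_⟩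
  refine (lintegral_rpow_lintegral_mul_le hk hu hr hA hB).trans ?_
  rw [Real.mul_rpow (by positivity) hD, Real.rpow_inv_rpow (by positivity) hr0.ne',
    ENNReal.ofReal_mul (by positivity), ENNReal.ofReal_toReal hfin]
  gcongr

/-! ### Schwartz functions: uniform summability and a convolution unit. -/

theorem SchwartzMap.exists_norm_le_div_one_add_sq (φ : SchwartzMap ℝ ℂ) :
    ∃ C, 0 < C ∧ ∀ x, ‖φ x‖ ≤ C * (1 + x ^ 2)⁻¹ := by
  obtain ⟨C₀, h₀, H₀⟩ := φ.decay 0 0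
  obtain ⟨C₂, h₂, H₂⟩ := φ.decay 2 0
  refine ⟨C₀ + C₂, by positivity, fun x => ?_⟩
  have a := H₀ x
  have b := H₂ x
  simp only [norm_iteratedFDeriv_zero, pow_zero, one_mul, Real.norm_eq_abs, sq_abs] at a b
  rw [← div_eq_mul_inv, le_div_iff₀ (by positivity)]
  linarith

theorem summable_inv_one_add_sq_int {a : ℝ} (ha : 0 < a) :
    Summable fun j : ℤ => (1 + ((j : ℝ) / a) ^ 2)⁻¹ := by
  have h := (Real.summable_one_div_int_pow.mpr one_lt_two).mul_left (a ^ 2)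
  refine Summable.of_norm_bounded_eventually h ?_
  rw [eventually_cofinite]
  refine (Set.finite_singleton (0 : ℤ)).subset fun j hj => ?_
  by_contra hne
  refine hj ?_
  have hj0 : (0 : ℝ) < (j : ℝ) ^ 2 := by
    have : (j : ℝ) ≠ 0 := by exact_mod_cast hne
    positivity
  rw [Real.norm_of_nonneg (by positivity), mul_one_div, div_pow, inv_le_comm₀ (by positivity)
    (by positivity), inv_div]
  linarith

theorem inv_one_add_sq_le_peetre (a b : ℝ) :
    (1 + (a - b) ^ 2)⁻¹ ≤ 2 * (1 + a ^ 2) * (1 + b ^ 2)⁻¹ := by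
  rw [← div_eq_mul_inv, inv_le_comm₀ (by positivity) (by positivity), inv_div,
    div_le_iff₀ (by positivity)]
  nlinarith [sq_nonneg (2 * a - b), sq_nonneg (a * (a - b)), sq_nonneg a]

/-- The integer translates (with step `1 / a`) of a Schwartz function are uniformly summable. -/
theorem SchwartzMap.exists_tsum_enorm_le (φ : SchwartzMap ℝ ℂ) {a : ℝ} (ha : 0 < a) :
    ∃ B : ℝ≥0∞, B ≠ ∞ ∧ ∀ x : ℝ, ∑' k : ℤ, ‖φ (x - k / a)‖ₑ ≤ B := by
  obtain ⟨C, hC, H⟩ := φ.exists_norm_le_div_one_add_sq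
  set D : ℝ := C * (2 * (1 + (1 / a) ^ 2))
  have hs := (summable_inv_one_add_sq_int ha).mul_left D
  refine ⟨_, hs.tsum_ofReal_ne_top, fun x => ?_⟩
  -- Shifting the index replaces `x` by `Int.fract (a * x) / a`, which lies in `[0, 1/a)`; Peetre's
  -- inequality then bounds the terms independently of `x`.
  rw [← (Equiv.addRight ⌊a * x⌋).tsum_eq]
  refine ENNReal.tsum_le_tsum fun j => ?_
  rw [← ofReal_norm]
  refine ENNReal.ofReal_le_ofReal ((H _).trans ?_)
  have hx : x - ((Equiv.addRight ⌊a * x⌋ j : ℤ) : ℝ) / a = Int.fract (a * x) / a - j / a := by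
    rw [Int.fract]
    simp only [Equiv.coe_addRight]
    push_cast
    field_simp
    ring
  rw [hx, mul_assoc]
  gcongr
  refine (inv_one_add_sq_le_peetre _ _).trans ?_
  gcongr
  exact (Int.fract_lt_one _).le

/-- There is a Schwartz function acting as a convolution unit on the kernel `K`. -/
theorem exists_schwartzMap_conv_bandKernel {Ω : Set ℝ} (hΩ : MeasurableSet Ω) {R ξ₀ : ℝ}
    (hR : 0 < R) (hΩR : Ω ⊆ Set.Icc (ξ₀ - R) (ξ₀ + R)) :
    ∃ φ : SchwartzMap ℝ ℂ, conv φ (bandKernel Ω) = bandKernel Ω := by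
  -- Inner radius `R` makes the bump equal to `1` on `Ω`; the outer radius is arbitrary.
  let b : ContDiffBump ξ₀ := ⟨R, R + 1, hR, by linarith⟩
  have hsupp : HasCompactSupport fun ξ => ((b ξ : ℝ) : ℂ) :=
    b.hasCompactSupport.comp_left (g := fun x : ℝ => (x : ℂ)) (by simp)
  have hsmooth : ContDiff ℝ (⊤ : ℕ∞) fun ξ => ((b ξ : ℝ) : ℂ) :=
    Complex.ofRealCLM.contDiff.comp b.contDiff
  let ψ : SchwartzMap ℝ ℂ := hsupp.toSchwartzMap hsmooth
  have hψ : ∀ ξ ∈ Ω, ψ ξ = 1 := by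
    intro ξ hξ
    have : b ξ = 1 := b.one_of_mem_closedBall (by
      rw [Real.closedBall_eq_Icc]; exact hΩR hξ)
    change ((b ξ : ℝ) : ℂ) = 1
    rw [this]; simp
  have hfin : volume Ω ≠ ∞ := ((measure_mono hΩR).trans_lt measure_Icc_lt_top).ne
  have : IsFiniteMeasure (volume.restrict Ω) := ⟨by simpa using hfin.lt_top⟩
  refine ⟨𝓕⁻ ψ, ?_⟩
  set φ : SchwartzMap ℝ ℂ := 𝓕⁻ ψ with hφ
  have hF : 𝓕 (φ : ℝ → ℂ) = ψ := by
    rw [← SchwartzMap.fourier_coe, hφ, FourierTransform.fourier_fourierInv_eq]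
  funext x
  rw [conv_apply]
  have h1 : ∀ y, φ y * bandKernel Ω (x - y) =
      ∫ ξ in Ω, φ y * Complex.exp (2 * Real.pi * (x - y : ℝ) * ξ * Complex.I) := by
    intro y
    rw [bandKernel_apply hΩ, integral_const_mul]
  simp_rw [h1]
  -- After Fubini the inner integral is `𝓕 φ ξ = ψ ξ = 1` times the exponential.
  rw [integral_integral_swap, bandKernel_apply hΩ]
  · refine setIntegral_congr_fun hΩ fun ξ hξ => ?_
    have h2 := congrFun hF ξ
    rw [hψ ξ hξ, Real.fourier_real_eq_integral_exp_smul] at h2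
    rw [← mul_one (Complex.exp _), ← h2, ← integral_const_mul]
    congr 1; funext y
    rw [smul_eq_mul, ← mul_assoc, ← Complex.exp_add, mul_comm]
    congr 2
    push_cast
    ring
  · have h3 : Integrable (fun p : ℝ × ℝ => φ p.1) (volume.prod (volume.restrict Ω)) :=
      φ.integrable.comp_fst _
    refine h3.mono ?_ ?_
    · refine h3.1.mul (Continuous.aestronglyMeasurable (by fun_prop))
    · refine ae_of_all _ fun p => ?_
      simp only [Function.uncurry, norm_mul, norm_cexp_two_pi_mul_I, mul_one, le_refl]

/-! ### Translation between power integrals or sums and norms. -/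

theorem memℓp_of_tsum_enorm_rpow_le {ι : Type*} {r : ℝ≥0∞} (hr : 0 < r.toReal) {c : ι → ℂ} {D : ℝ}
    (hD : 0 ≤ D) (h : ∑' k, ‖c k‖ₑ ^ r.toReal ≤ ENNReal.ofReal (D ^ r.toReal)) :
    ∃ hc : Memℓp c r, ‖(⟨c, hc⟩ : coeffSpace ι r)‖ ≤ D := by
  have e : ∀ k, ‖c k‖ₑ ^ r.toReal = ENNReal.ofReal (‖c k‖ ^ r.toReal) := fun k => by
    rw [← ofReal_norm, ENNReal.ofReal_rpow_of_nonneg (norm_nonneg _) hr.le]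
  have hs : Summable fun k => ‖c k‖ ^ r.toReal := by
    have := ENNReal.summable_toReal (h.trans_lt ENNReal.ofReal_lt_top).ne
    refine this.congr fun k => ?_
    rw [e, ENNReal.toReal_ofReal (by positivity)]
  refine ⟨memℓp_gen hs, lp.norm_le_of_tsum_le hr hD ?_⟩
  simp_rw [e] at h
  rw [← ENNReal.ofReal_tsum_of_nonneg (fun k => by positivity) hs] at h
  exact (ENNReal.ofReal_le_ofReal_iff (by positivity)).mp h

theorem lp.tsum_enorm_rpow_eq {ι : Type*} {r : ℝ≥0∞} (hr : 0 < r.toReal) (c : coeffSpace ι r) :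
    ∑' k, ‖c k‖ₑ ^ r.toReal = ENNReal.ofReal (‖c‖ ^ r.toReal) := by
  rw [lp.norm_rpow_eq_tsum hr, ENNReal.ofReal_tsum_of_nonneg (fun k => by positivity)
    ((memℓp_gen_iff hr).mp (lp.memℓp c))]
  congr 1; funext k
  rw [← ofReal_norm, ENNReal.ofReal_rpow_of_nonneg (norm_nonneg _) hr.le]

theorem MeasureTheory.Lp.lintegral_enorm_rpow_eq {α : Type*} [MeasurableSpace α] {μ : Measure α}
    {r : ℝ≥0∞} (h0 : r ≠ 0) (h1 : r ≠ ∞) (f : Lp ℂ r μ) :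
    ∫⁻ x, ‖f x‖ₑ ^ r.toReal ∂μ = ENNReal.ofReal (‖f‖ ^ r.toReal) := by
  have hr := ENNReal.toReal_pos h0 h1
  rw [Lp.norm_def, ENNReal.toReal_rpow, ENNReal.ofReal_toReal
      (ENNReal.rpow_ne_top_of_nonneg hr.le (Lp.eLpNorm_ne_top f)),
    eLpNorm_eq_lintegral_rpow_enorm_toReal h0 h1, ← ENNReal.rpow_mul, one_div_mul_cancel hr.ne',
    ENNReal.rpow_one]

theorem memLp_of_lintegral_enorm_rpow_le {α : Type*} [MeasurableSpace α] {μ : Measure α}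
    {r : ℝ≥0∞} (h0 : r ≠ 0) (h1 : r ≠ ∞) {f : α → ℂ} (hf : AEStronglyMeasurable f μ) {D : ℝ}
    (hD : 0 ≤ D) (h : ∫⁻ x, ‖f x‖ₑ ^ r.toReal ∂μ ≤ ENNReal.ofReal (D ^ r.toReal)) :
    ∃ hf' : MemLp f r μ, ‖hf'.toLp f‖ ≤ D := by
  have hr := ENNReal.toReal_pos h0 h1
  have key : eLpNorm f r μ ≤ ENNReal.ofReal D := by
    rw [eLpNorm_eq_lintegral_rpow_enorm_toReal h0 h1, one_div, ENNReal.rpow_inv_le_iff hr,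
      ENNReal.ofReal_rpow_of_nonneg hD hr.le]
    exact h
  have hf' : MemLp f r μ := ⟨hf, key.trans_lt ENNReal.ofReal_lt_top⟩
  refine ⟨hf', ?_⟩
  rw [Lp.norm_toLp]
  exact ENNReal.toReal_le_of_le_ofReal hD key

/-! ### Convolution for conjugate exponents. -/

section Holder

variable {r q : ℝ≥0∞}

theorem convolutionExistsAt_of_memLp [r.HolderConjugate q] {f g : ℝ → ℂ}
    (hf : MemLp f r volume) (hg : MemLp g q volume) (x : ℝ) :
    ConvolutionExistsAt f g x (ContinuousLinearMap.mul ℂ ℂ) volume :=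
  hf.integrable_mul (hg.comp_measurePreserving (Measure.measurePreserving_sub_left volume x))

theorem enorm_conv_le [r.HolderConjugate q] {f g : ℝ → ℂ}
    (hf : MemLp f r volume) (hg : MemLp g q volume) (x : ℝ) :
    ‖conv f g x‖ₑ ≤ eLpNorm f r volume * eLpNorm g q volume := by
  have hmp := Measure.measurePreserving_sub_left (volume : Measure ℝ) x
  calc ‖conv f g x‖ₑ ≤ ∫⁻ y, ‖(f • (g ∘ fun y => x - y)) y‖ₑ :=
        enorm_integral_le_lintegral_enorm _
    _ = eLpNorm (f • (g ∘ fun y => x - y)) 1 volume := eLpNorm_one_eq_lintegral_enorm.symm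
    _ ≤ eLpNorm f r volume * eLpNorm (g ∘ fun y => x - y) q volume :=
        eLpNorm_smul_le_mul_eLpNorm (hg.comp_measurePreserving hmp).1 hf.1
    _ = _ := by rw [eLpNorm_comp_measurePreserving hg.1 hmp]

theorem conv_add_left {f f' g : ℝ → ℂ} {x : ℝ}
    (hf : ConvolutionExistsAt f g x (ContinuousLinearMap.mul ℂ ℂ) volume)
    (hf' : ConvolutionExistsAt f' g x (ContinuousLinearMap.mul ℂ ℂ) volume) :
    conv (f + f') g x = conv f g x + conv f' g x :=
  hf.add_distrib hf'

theorem conv_smul_left (c : ℂ) (f g : ℝ → ℂ) : conv (c • f) g = c • conv f g :=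
  smul_convolution

theorem conv_coeFn_add [r.HolderConjugate q] {g : ℝ → ℂ} (hg : MemLp g q volume)
    (f f' : Lp ℂ r (volume : Measure ℝ)) :
    conv (⇑(f + f')) g = conv f g + conv f' g := by
  rw [conv_congr_left (Lp.coeFn_add f f')]
  funext x
  exact conv_add_left (convolutionExistsAt_of_memLp (Lp.memLp f) hg x)
    (convolutionExistsAt_of_memLp (Lp.memLp f') hg x)

theorem conv_coeFn_smul (c : ℂ) (f : Lp ℂ r (volume : Measure ℝ)) (g : ℝ → ℂ) :
    conv (⇑(c • f)) g = c • conv f g := by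
  rw [conv_congr_left (Lp.coeFn_smul c f), conv_smul_left]

/-- For fixed `x`, the functional `f ↦ (f ∗ g) x` is continuous on `L_r` if `g ∈ L_q`. -/
theorem tendsto_conv_apply [r.HolderConjugate q] [Fact (1 ≤ r)] {g : ℝ → ℂ}
    (hg : MemLp g q volume) {ι : Type*} {l : Filter ι} {u : ι → Lp ℂ r (volume : Measure ℝ)}
    {f : Lp ℂ r (volume : Measure ℝ)} (hu : Tendsto u l (nhds f)) (x : ℝ) :
    Tendsto (fun i => conv (u i) g x) l (nhds (conv f g x)) := by
  let Λ : Lp ℂ r (volume : Measure ℝ) →ₗ[ℂ] ℂ :=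
    { toFun := fun f => conv f g x
      map_add' := fun f f' => by rw [conv_coeFn_add hg]; rfl
      map_smul' := fun c f => by rw [conv_coeFn_smul]; rfl }
  let Λ' := Λ.mkContinuous (eLpNorm g q volume).toReal fun f => by
    have := enorm_conv_le (Lp.memLp f) hg x
    have := ENNReal.toReal_mono (ENNReal.mul_ne_top (Lp.eLpNorm_ne_top f) hg.2.ne) this
    rw [ENNReal.toReal_mul, toReal_enorm, ← Lp.norm_def, mul_comm] at this
    exact this
  exact (Λ'.continuous.tendsto f).comp hu

end Holder

/-! ### Bounded convolution, sampling and synthesis operators. -/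

section Operators

variable {r : ℝ≥0∞} [Fact (1 ≤ r)]

/-- Right convolution with `g` as a bounded operator on `L_r`. -/
theorem exists_conv_clm {q : ℝ≥0∞} [r.HolderConjugate q] {g : ℝ → ℂ} (hg : MemLp g q volume)
    (h : RightConvolutionWellDefined r g) :
    ∃ T : Lp ℂ r (volume : Measure ℝ) →L[ℂ] Lp ℂ r (volume : Measure ℝ),
      ∀ f, ⇑(T f) =ᵐ[volume] conv f g := by
  let T : Lp ℂ r (volume : Measure ℝ) →ₗ[ℂ] Lp ℂ r (volume : Measure ℝ) :=
    { toFun := fun f => (h f (Lp.memLp f)).2.toLp _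
      map_add' := fun f f' => by
        rw [← MemLp.toLp_add]
        exact MemLp.toLp_congr _ _ (by rw [conv_coeFn_add hg])
      map_smul' := fun c f => by
        rw [RingHom.id_apply, ← MemLp.toLp_const_smul]
        exact MemLp.toLp_congr _ _ (by rw [conv_coeFn_smul]) }
  have hT : ∀ f, ⇑(T f) =ᵐ[volume] conv f g := fun f =>
    MemLp.coeFn_toLp (h f (Lp.memLp f)).2
  -- Closed graph: a subsequence of the images converges a.e. to `y`, while Hölder makes `u ↦ (u ∗
  -- g) x` continuous at every `x`.
  refine ⟨⟨T, T.continuous_of_seq_closed_graph fun u f y hu hy => ?_⟩, hT⟩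
  obtain ⟨ns, hns, hae⟩ := (tendstoInMeasure_of_tendsto_Lp hy).exists_seq_tendsto_ae'
  refine Lp.ext ?_
  have hall : ∀ᵐ x, ∀ i, T (u (ns i)) x = conv (u (ns i)) g x :=
    ae_all_iff.mpr fun i => hT _
  filter_upwards [hae, hall, hT f] with x h1 h2 h3
  rw [h3]
  refine tendsto_nhds_unique h1 ?_
  simp only [Function.comp, h2]
  exact tendsto_conv_apply hg (hu.comp hns) x

/-- Sampling of a convolution with a Schwartz function is bounded from `L_r` to `ℓ_r`. -/
theorem exists_sample_conv_clm (hr1 : 1 < r) (hr : r < ∞) (φ : SchwartzMap ℝ ℂ) {a : ℝ}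
    (ha : 0 < a) :
    ∃ S : Lp ℂ r (volume : Measure ℝ) →L[ℂ] coeffSpace ℤ r,
      ∀ f k, S f k = conv f φ (k / a) := by
  have hr0 : 0 < r.toReal := ENNReal.toReal_pos (by positivity) hr.ne
  have hr1' : 1 < r.toReal := by
    simpa using (ENNReal.toReal_lt_toReal ENNReal.one_ne_top hr.ne).mpr hr1
  have : r.HolderConjugate r.conjExponent := .conjExponent hr1.le
  have hφ : MemLp φ r.conjExponent volume := φ.memLp _
  obtain ⟨M, hM0, hM⟩ := exists_lintegral_rpow_lintegral_mul_le (Measure.count : Measure ℤ)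
    (volume : Measure ℝ) (k := fun k y => ‖φ (k / a - y)‖ₑ) (r := r.toReal)
    (Continuous.measurable (by fun_prop)) hr1'
    ⟨∫⁻ y, ‖φ y‖ₑ, φ.integrable.2.ne, fun k =>
      (lintegral_sub_left_eq_self (fun y => ‖φ y‖ₑ) _).le⟩ (by
      -- The kernel here is `φ(k/a - y)`, so the uniform sum bound is applied to the reflection of
      -- `φ`.
      obtain ⟨B, hB, h⟩ := (SchwartzMap.compCLMOfContinuousLinearEquiv ℂ
        (ContinuousLinearEquiv.neg ℝ : ℝ ≃L[ℝ] ℝ) φ).exists_tsum_enorm_le ha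
      refine ⟨B, hB, fun y => ?_⟩
      rw [lintegral_count]
      refine le_of_eq_of_le ?_ (h y)
      congr 1; funext k
      simp)
  have bound : ∀ f : Lp ℂ r (volume : Measure ℝ),
      ∑' k : ℤ, ‖conv f φ (k / a)‖ₑ ^ r.toReal ≤ ENNReal.ofReal ((M * ‖f‖) ^ r.toReal) := by
    intro f
    refine le_trans ?_ (hM (fun y => ‖f y‖ₑ) (Lp.aestronglyMeasurable f).enorm ‖f‖ (norm_nonneg _)
      (Lp.lintegral_enorm_rpow_eq (by positivity) hr.ne f).le)
    rw [lintegral_count]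
    refine ENNReal.tsum_le_tsum fun k => ?_
    gcongr
    refine (enorm_integral_le_lintegral_enorm _).trans_eq ?_
    congr 1; funext y
    rw [ContinuousLinearMap.mul_apply', enorm_mul, mul_comm]
  choose h1 h2 using fun f => memℓp_of_tsum_enorm_rpow_le hr0 (by positivity) (bound f)
  let S : Lp ℂ r (volume : Measure ℝ) →ₗ[ℂ] coeffSpace ℤ r :=
    { toFun := fun f => ⟨_, h1 f⟩
      map_add' := fun f f' => by
        ext k
        change conv (⇑(f + f')) φ (k / a) = conv f φ (k / a) + conv f' φ (k / a)
        rw [conv_coeFn_add hφ]; rfl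
      map_smul' := fun c f => by
        ext k
        change conv (⇑(c • f)) φ (k / a) = c • conv f φ (k / a)
        rw [conv_coeFn_smul]; rfl }
  exact ⟨S.mkContinuous M h2, fun f k => rfl⟩

/-- Synthesis from the translates of a Schwartz function is bounded from `ℓ_r` to `L_r`. -/
theorem exists_synthesis_clm (hr1 : 1 < r) (hr : r < ∞) (φ : SchwartzMap ℝ ℂ) {a : ℝ}
    (ha : 0 < a) :
    ∃ S : coeffSpace ℤ r →L[ℂ] Lp ℂ r (volume : Measure ℝ),
      ∀ c, ⇑(S c) =ᵐ[volume] fun x => ∑' k : ℤ, c k * φ (x - k / a) := by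
  have hr0 : 0 < r.toReal := ENNReal.toReal_pos (by positivity) hr.ne
  have hr1' : 1 < r.toReal := by
    simpa using (ENNReal.toReal_lt_toReal ENNReal.one_ne_top hr.ne).mpr hr1
  obtain ⟨B, hB, hBφ⟩ := φ.exists_tsum_enorm_le ha
  obtain ⟨M, hM0, hM⟩ := exists_lintegral_rpow_lintegral_mul_le (volume : Measure ℝ)
    (Measure.count : Measure ℤ) (k := fun x k => ‖φ (x - k / a)‖ₑ) (r := r.toReal)
    (Continuous.measurable (by fun_prop)) hr1'
    ⟨B, hB, fun x => by rw [lintegral_count]; exact hBφ x⟩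
    ⟨∫⁻ y, ‖φ y‖ₑ, φ.integrable.2.ne, fun k =>
      (lintegral_sub_right_eq_self (fun y => ‖φ y‖ₑ) _).le⟩
  have hsum : ∀ (c : coeffSpace ℤ r) x, Summable fun k : ℤ => c k * φ (x - k / a) := by
    intro c x
    have h := ENNReal.summable_toReal ((hBφ x).trans_lt hB.lt_top).ne
    refine Summable.of_norm_bounded (h.mul_left ‖c‖) fun k => ?_
    rw [norm_mul, toReal_enorm]
    gcongr
    exact lp.norm_apply_le_norm (by positivity) c k
  have bound : ∀ c : coeffSpace ℤ r, ∫⁻ x, ‖∑' k : ℤ, c k * φ (x - k / a)‖ₑ ^ r.toReal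
      ≤ ENNReal.ofReal ((M * ‖c‖) ^ r.toReal) := by
    intro c
    refine le_trans ?_ (hM (fun k => ‖c k‖ₑ) (measurable_of_countable _).aemeasurable ‖c‖
      (norm_nonneg _) (by rw [lintegral_count, lp.tsum_enorm_rpow_eq hr0]))
    refine lintegral_mono fun x => ?_
    dsimp only
    rw [lintegral_count]
    gcongr
    refine enorm_tsum_le_tsum_enorm.trans_eq ?_
    congr 1; funext k
    rw [enorm_mul, mul_comm]
  have hmeas : ∀ c : coeffSpace ℤ r,
      AEStronglyMeasurable (fun x => ∑' k : ℤ, c k * φ (x - k / a)) volume := fun c =>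
    (StronglyMeasurable.tsum fun k => Continuous.stronglyMeasurable
      (by fun_prop)).aestronglyMeasurable
  choose h1 h2 using fun c => memLp_of_lintegral_enorm_rpow_le (zero_lt_one.trans hr1).ne' hr.ne
    (hmeas c) (mul_nonneg hM0 (norm_nonneg c)) (bound c)
  let S : coeffSpace ℤ r →ₗ[ℂ] Lp ℂ r (volume : Measure ℝ) :=
    { toFun := fun c => (h1 c).toLp _
      map_add' := fun c c' => by
        rw [← MemLp.toLp_add]
        refine MemLp.toLp_congr _ _ (ae_of_all _ fun x => ?_)
        simp only [Pi.add_apply, lp.coeFn_add, add_mul]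
        exact (hsum c x).tsum_add (hsum c' x)
      map_smul' := fun z c => by
        rw [RingHom.id_apply, ← MemLp.toLp_const_smul]
        refine MemLp.toLp_congr _ _ (ae_of_all _ fun x => ?_)
        simp only [Pi.smul_apply, lp.coeFn_smul, smul_eq_mul, mul_assoc]
        exact tsum_mul_left }
  exact ⟨S.mkContinuous M h2, fun c => MemLp.coeFn_toLp (h1 c)⟩

end Operators

/-! ### Algebra of convolution and density of integrable functions. -/

theorem conv_comm (f g : ℝ → ℂ) : conv f g = conv g f := by
  funext x
  rw [conv_apply, conv_apply, ← integral_sub_left_eq_self _ volume x]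
  congr 1; funext y
  rw [sub_sub_cancel, mul_comm]

theorem conv_translate_left (f g : ℝ → ℂ) (a x : ℝ) :
    conv (fun y => f (y - a)) g x = conv f g (x - a) := by
  rw [conv_apply, conv_apply, ← integral_add_right_eq_self _ a]
  congr 1; funext y
  rw [add_sub_cancel_right, sub_sub, add_comm]

/-- Fubini applies because `|g| ∗ |k|` is bounded by Hölder and `h` is integrable. -/
theorem conv_assoc {p q : ℝ≥0∞} [p.HolderConjugate q] {h g k : ℝ → ℂ} (hh : Integrable h)
    (hg : MemLp g p volume) (hk : MemLp k q volume)
    (hhg : ∀ x, ConvolutionExistsAt h g x (ContinuousLinearMap.mul ℂ ℂ) volume) :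
    conv (conv h g) k = conv h (conv g k) := by
  funext x
  have hmp := fun x => Measure.measurePreserving_sub_left (volume : Measure ℝ) x
  have hgk : ∀ x, ConvolutionExistsAt (fun x => ‖g x‖) (fun x => ‖k x‖) x
      (ContinuousLinearMap.mul ℝ ℝ) volume := fun x =>
    hg.norm.integrable_mul (hk.norm.comp_measurePreserving (hmp x))
  refine convolution_assoc _ _ _ _ (fun x y z => mul_assoc x y z) hh.1 hg.1 hk.1
    (ae_of_all _ hhg) (ae_of_all _ hgk) ?_
  have hmeas : AEStronglyMeasurable
      ((fun x => ‖g x‖) ⋆[ContinuousLinearMap.mul ℝ ℝ, volume] fun x => ‖k x‖) volume :=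
    (hg.1.norm.convolution_integrand (ContinuousLinearMap.mul ℝ ℝ)
      hk.1.norm).integral_prod_right'
  refine Integrable.mul_bdd (c := (eLpNorm g p volume * eLpNorm k q volume).toReal) hh.norm
    (hmeas.comp_measurePreserving (hmp x)) (ae_of_all _ fun y => ?_)
  have hfin : eLpNorm g p volume * eLpNorm k q volume ≠ ∞ := ENNReal.mul_ne_top hg.2.ne hk.2.ne
  have := enorm_conv_le (f := fun x => (‖g x‖ : ℂ)) (g := fun x => (‖k x‖ : ℂ)) hg.norm.ofReal
    hk.norm.ofReal (x - y)
  have e : ∀ (f : ℝ → ℂ) (p : ℝ≥0∞),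
      eLpNorm (fun x => (‖f x‖ : ℂ)) p volume = eLpNorm f p volume :=
    fun f p => eLpNorm_congr_norm_ae (ae_of_all _ fun x => by simp)
  rw [e, e] at this
  rw [← toReal_enorm]
  refine ENNReal.toReal_mono hfin (le_of_eq_of_le ?_ this)
  rw [conv_apply, convolution_def]
  simp only [ContinuousLinearMap.mul_apply', ← Complex.ofReal_mul]
  rw [integral_complex_ofReal, ← ofReal_norm, ← ofReal_norm, Complex.norm_real]

theorem dense_integrable_Lp {α : Type*} [MeasurableSpace α] {μ : Measure α} {r : ℝ≥0∞}
    [Fact (1 ≤ r)] (hr : r ≠ ∞) : Dense {f : Lp ℂ r μ | Integrable f μ} := by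
  refine Dense.mono ?_ (Lp.simpleFunc.denseRange (E := ℂ) (μ := μ) hr)
  rintro _ ⟨s, rfl⟩
  have h0 : r ≠ 0 := (zero_lt_one.trans_le Fact.out).ne'
  refine Integrable.congr ?_ (Lp.simpleFunc.toSimpleFunc_eq_toFun s)
  rw [← SimpleFunc.memLp_iff_integrable h0 hr]
  exact Lp.simpleFunc.memLp s

/-! ### Continuous representatives and the pairing with translates. -/

section Kernel

variable {Ω : Set ℝ}

theorem norm_bandKernel_le (hΩ : MeasurableSet Ω) (x : ℝ) :
    ‖bandKernel Ω x‖ ≤ volume.real Ω := by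
  rw [bandKernel_apply hΩ]
  refine (norm_integral_le_integral_norm _).trans_eq ?_
  simp [norm_cexp_two_pi_mul_I]

/-- By Hölder, `f ∗ K` is a uniform limit of `h ∗ K` with `h` integrable, and these are continuous
since `K` is bounded and continuous. -/
theorem continuous_conv_bandKernel (hΩ : MeasurableSet Ω) (hfin : volume Ω ≠ ∞) {r q : ℝ≥0∞}
    [Fact (1 ≤ r)] [r.HolderConjugate q] (hr : r ≠ ∞) (hK : MemLp (bandKernel Ω) q volume)
    (f : Lp ℂ r (volume : Measure ℝ)) : Continuous (conv f (bandKernel Ω)) := by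
  refine continuous_of_uniform_approx_of_continuous fun U hU => ?_
  obtain ⟨ε, hε, hεU⟩ := mem_uniformity_edist.mp hU
  have hC : eLpNorm (bandKernel Ω) q volume ≠ ∞ := hK.2.ne
  obtain ⟨δ, hδ, hδε⟩ : ∃ δ > 0, δ * eLpNorm (bandKernel Ω) q volume < ε :=
    ENNReal.exists_pos_mul_lt hC hε.ne'
  obtain ⟨h, hh, hd⟩ := EMetric.mem_closure_iff.mp (dense_integrable_Lp hr f) δ hδ
  refine ⟨conv h (bandKernel Ω), ?_, fun x => hεU ?_⟩
  · refine BddAbove.continuous_convolution_right_of_integrable _ ?_ hh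
      (continuous_bandKernel hΩ hfin)
    exact ⟨volume.real Ω, by rintro _ ⟨x, rfl⟩; exact norm_bandKernel_le hΩ x⟩
  · have e : conv f (bandKernel Ω) x - conv h (bandKernel Ω) x =
        conv (⇑(f - h)) (bandKernel Ω) x := by
      rw [sub_eq_iff_eq_add]
      conv_lhs => rw [← sub_add_cancel f h]
      rw [conv_coeFn_add hK]; rfl
    rw [edist_eq_enorm_sub, e]
    refine (enorm_conv_le (Lp.memLp _) hK x).trans_lt (lt_of_le_of_lt ?_ hδε)
    gcongr
    rw [← Lp.enorm_def, ← edist_eq_enorm_sub]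
    exact hd.le

/-- If `φ ∗ K = K`, then `φ` is a convolution unit on all products `f ∗ K` with `f ∈ L_r`. -/
theorem conv_conv_eq_of_conv_eq {K : ℝ → ℂ} {r q : ℝ≥0∞} [r.HolderConjugate q]
    (hK : MemLp K q volume) {φ : SchwartzMap ℝ ℂ} (hφ : conv φ K = K) {f : ℝ → ℂ}
    (hf : MemLp f r volume) : conv (conv f K) φ = conv f K := by
  -- Commuting puts the integrable factor `φ` leftmost, as associativity requires.
  rw [conv_comm (conv f K), conv_comm f K, ← conv_assoc (p := q) (q := r) φ.integrable hK hf
    (convolutionExistsAt_of_memLp (φ.memLp r) hK), hφ]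

theorem pairingL2_leftTranslate_bandKernel (hΩ : MeasurableSet Ω) (f : ℝ → ℂ) (a : ℝ) :
    pairingL2 f (leftTranslate a (bandKernel Ω)) = conv f (bandKernel Ω) a := by
  rw [conv_apply, pairingL2]
  congr 1; funext y
  rw [leftTranslate, ← bandKernel_neg hΩ, neg_sub]

end Kernel

/-- Some sequence of partial sums converges a.e., which identifies the `L_r` sum with the pointwise
one. -/
theorem Lp.ae_eq_of_hasSum {α ι : Type*} [Countable ι] [MeasurableSpace α] {μ : Measure α}
    {r : ℝ≥0∞} [Fact (1 ≤ r)] {F : ι → Lp ℂ r μ} {G : Lp ℂ r μ} (h : HasSum F G) {f : ι → α → ℂ}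
    {g : α → ℂ} (hF : ∀ i, F i =ᵐ[μ] f i) (hfg : ∀ x, HasSum (fun i => f i x) (g x)) :
    G =ᵐ[μ] g := by
  obtain ⟨ns, hns, hae⟩ := (tendstoInMeasure_of_tendsto_Lp h).exists_seq_tendsto_ae'
  have hsum : ∀ s : Finset ι, ⇑(∑ i ∈ s, F i) =ᵐ[μ] fun x => ∑ i ∈ s, f i x := by
    intro s
    filter_upwards [Lp.coeFn_finsetSum s F, ae_all_iff.mpr hF] with x h1 h2
    rw [h1, Finset.sum_apply]
    exact Finset.sum_congr rfl fun i _ => h2 i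
  filter_upwards [hae, ae_all_iff.mpr fun i => hsum (ns i)] with x h1 h2
  refine tendsto_nhds_unique h1 ?_
  simp only [h2]
  exact (hfg x).comp hns

/-! ### The frame theorem. -/

theorem proposition5
    (Ω : Set ℝ) (hΩ : MeasurableSet Ω)
    (r : ℝ≥0∞) [Fact (1 ≤ r)] (hr1 : 1 < r) (hr : r < ∞) (hr2 : r ≠ 2)
    (R ξ₀ : ℝ) (hR : 0 < R) (hΩR : Ω ⊆ Set.Icc (ξ₀ - R) (ξ₀ + R))
    (hK : ∀ p : ℝ≥0∞, 1 < p → p < ∞ → MemLp (bandKernel Ω) p volume)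
    (hRC : RightConvolutionWellDefined r (bandKernel Ω)) :
    ∃ atom : ℤ → reproducingSpace r (bandKernel Ω),
      -- `atom k` is the element of the reproducing kernel space given by `λ(k/(2R)) K`
      (∀ k : ℤ, ⇑(atom k : Lp ℂ r (volume : Measure ℝ)) =ᵐ[volume]
        leftTranslate ((k : ℝ) / (2 * R)) (bandKernel Ω)) ∧
      -- the pairings `⟨f, λ(k/(2R)) K⟩` are given by convergent integrals
      (∀ (f : reproducingSpace r (bandKernel Ω)) (k : ℤ),
        Integrable (fun x : ℝ => (f : Lp ℂ r (volume : Measure ℝ)) x *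
          conj (leftTranslate ((k : ℝ) / (2 * R)) (bandKernel Ω) x)) volume) ∧
      IsBanachFrame r (fun (k : ℤ) (f : reproducingSpace r (bandKernel Ω)) =>
        pairingL2 (f : Lp ℂ r (volume : Measure ℝ))
          (leftTranslate ((k : ℝ) / (2 * R)) (bandKernel Ω))) ∧
      IsAtomicDecomposition r atom ∧
      ∃ (Samp : reproducingSpace r (bandKernel Ω) →L[ℂ] coeffSpace ℤ r)
        (Synth : coeffSpace ℤ r →L[ℂ] reproducingSpace r (bandKernel Ω)),
        -- `Samp f` samples the (unique) continuous representative of `f`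
        (∀ f : reproducingSpace r (bandKernel Ω), ∃ g : ℝ → ℂ, Continuous g ∧
          ⇑(f : Lp ℂ r (volume : Measure ℝ)) =ᵐ[volume] g ∧
          ∀ k : ℤ, Samp f k = g ((k : ℝ) / (2 * R))) ∧
        (∀ (f : reproducingSpace r (bandKernel Ω)) (k : ℤ),
          Samp f k = pairingL2 (f : Lp ℂ r (volume : Measure ℝ))
            (leftTranslate ((k : ℝ) / (2 * R)) (bandKernel Ω))) ∧
        (∀ c : coeffSpace ℤ r, HasSum (fun k : ℤ => c k • atom k) (Synth c)) ∧
        Synth ∘L Samp =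
          ((2 * R : ℝ) : ℂ) • ContinuousLinearMap.id ℂ (reproducingSpace r (bandKernel Ω)) := by

  have : r.HolderConjugate r.conjExponent := .conjExponent hr1.le
  set q := r.conjExponent
  have hq1 : 1 < q := (ENNReal.HolderConjugate.lt_top_iff_one_lt r q).mp hr
  have hq : q < ∞ := (ENNReal.HolderConjugate.lt_top_iff_one_lt q r).mpr hr1
  have hfin : volume Ω ≠ ∞ := ((measure_mono hΩR).trans_lt measure_Icc_lt_top).ne
  have ha : 0 < 2 * R := by positivity
  set K := bandKernel Ω
  have hneg : ∀ x, K (-x) = conj (K x) := bandKernel_neg hΩ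
  have hKq : MemLp K q volume := hK q hq1 hq
  have hK2 : MemLp K 2 volume := hK 2 (by norm_num) (by norm_num)
  have hKK : conv K K = K := conv_bandKernel_self hΩ hR hΩR hK2
  obtain ⟨φ, hφ⟩ := exists_schwartzMap_conv_bandKernel hΩ hR hΩR
  obtain ⟨T, hT⟩ := exists_conv_clm hKq hRC
  obtain ⟨S, hS⟩ := exists_sample_conv_clm (r := r) hr1 hr φ ha
  obtain ⟨Φ, hΦ⟩ := exists_synthesis_clm (r := r) hr1 hr φ ha
  have hdense := dense_integrable_Lp (μ := (volume : Measure ℝ)) hr.ne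
  -- Associativity needs an integrable left factor, so `(h ∗ K) ∗ K = h ∗ (K ∗ K)` is used on a
  -- dense set only.
  have hTT : ∀ f, T (T f) = T f := by
    refine congrFun (Continuous.ext_on hdense (T.continuous.comp T.continuous) T.continuous
      fun h hh => ?_)
    refine Lp.ext ((hT _).trans (EventuallyEq.trans ?_ (hT h).symm))
    rw [conv_congr_left (hT h), conv_assoc hh hK2 hK2
      (convolutionExistsAt_of_memLp (Lp.memLp h) hKq), hKK]
  have hTmem : ∀ f, T f ∈ reproducingSpace r K := fun f =>
    ⟨ae_of_all _ (convolutionExistsAt_of_memLp (Lp.memLp _) hKq), by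
      refine (hT (T f)).symm.trans ?_
      rw [hTT]⟩
  have hfix : ∀ f : reproducingSpace r K,
      conv f K =ᵐ[volume] (f : Lp ℂ r (volume : Measure ℝ)) := fun f => f.2.2
  let P : Lp ℂ r (volume : Measure ℝ) →L[ℂ] reproducingSpace r K := T.codRestrict _ hTmem
  have hP : ∀ f : reproducingSpace r K, P f = f := fun f =>
    Subtype.ext (Lp.ext ((hT f).trans (hfix f)))
  let Synth : coeffSpace ℤ r →L[ℂ] reproducingSpace r K := P ∘L Φ
  let Samp : reproducingSpace r K →L[ℂ] coeffSpace ℤ r := S ∘L (reproducingSpace r K).subtypeL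
  let atom : ℤ → reproducingSpace r K := fun k => Synth (lp.single r k 1)
  have hatom : ∀ k : ℤ, ⇑(atom k : Lp ℂ r (volume : Measure ℝ)) =ᵐ[volume]
      leftTranslate (k / (2 * R)) K := by
    intro k
    refine (hT (Φ (lp.single r k 1))).trans ?_
    have e : ⇑(Φ (lp.single r k 1)) =ᵐ[volume] fun x => φ (x - k / (2 * R)) := by
      refine (hΦ _).trans (ae_of_all _ fun x => ?_)
      dsimp only
      rw [tsum_eq_single k fun j hj => by rw [lp.single_apply_ne _ _ _ hj, zero_mul],
        lp.single_apply_self, one_mul]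
    rw [conv_congr_left e]
    refine ae_of_all _ fun x => ?_
    rw [conv_translate_left, hφ, leftTranslate]
  have hsynth : ∀ c : coeffSpace ℤ r, HasSum (fun k : ℤ => c k • atom k) (Synth c) := by
    intro c
    refine ((lp.hasSum_single hr.ne c).mapL Synth).of_eq (fun k => ?_) rfl
    rw [← map_smul, ← lp.single_smul, smul_eq_mul, mul_one]
  -- This lets `Samp`, defined through `φ` and hence bounded, take the values of `f ∗ K`.
  have hconv : ∀ f : reproducingSpace r K, conv f φ = conv f K := fun f => by
    rw [← conv_congr_left (hfix f), conv_conv_eq_of_conv_eq hKq hφ (Lp.memLp _)]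
  have hsamp : ∀ (f : reproducingSpace r K) (k : ℤ), Samp f k = conv f K (k / (2 * R)) :=
    fun f k => (hS f k).trans (congrFun (hconv f) _)
  have hpair : ∀ (f : reproducingSpace r K) (k : ℤ), Samp f k =
      pairingL2 (f : Lp ℂ r (volume : Measure ℝ)) (leftTranslate (k / (2 * R)) K) := fun f k => by
    rw [hsamp, pairingL2_leftTranslate_bandKernel hΩ]
  -- Stated on all of `L_r` through `P`, so that density of integrable functions in `L_r` suffices
  -- and none is needed inside the reproducing space.
  have hPT : ∀ f, Synth (Samp (P f)) = ((2 * R : ℝ) : ℂ) • P f := by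
    refine congrFun (Continuous.ext_on hdense (by fun_prop) (by fun_prop) fun h hh => ?_)
    refine Subtype.ext (Lp.ext ?_)
    have hh' : conv (P h : Lp ℂ r (volume : Measure ℝ)) K = conv h K := by
      refine (conv_congr_left (hT h)).trans ?_
      rw [conv_assoc hh hK2 hK2
        (convolutionExistsAt_of_memLp (Lp.memLp h) hKq), hKK]
    have h1 := (hsynth (Samp (P h))).mapL (reproducingSpace r K).subtypeL
    have h2 : ∀ k : ℤ, ⇑((reproducingSpace r K).subtypeL (Samp (P h) k • atom k)) =ᵐ[volume]
        fun x => conv h K (k / (2 * R)) * K (x - k / (2 * R)) := by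
      intro k
      rw [map_smul]
      filter_upwards [Lp.coeFn_smul (Samp (P h) k) ((reproducingSpace r K).subtypeL (atom k)),
        hatom k] with x hx1 hx2
      rw [hx1, Pi.smul_apply, smul_eq_mul, hsamp, hh', Submodule.subtypeL_apply, hx2]
      rfl
    refine (Lp.ae_eq_of_hasSum h1 h2 (hasSum_conv_bandKernel hΩ hR hΩR hh)).trans ?_
    filter_upwards [Lp.coeFn_smul ((2 * R : ℝ) : ℂ) (T h), hT h] with x hx1 hx2
    refine Eq.trans ?_ hx1.symm
    rw [Pi.smul_apply, hx2, smul_eq_mul]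
    push_cast
    rfl
  have hid : Synth ∘L Samp = ((2 * R : ℝ) : ℂ) • ContinuousLinearMap.id ℂ _ := by
    ext1 f
    have := hPT f
    rw [hP] at this
    exact this
  have hne : ((2 * R : ℝ) : ℂ) ≠ 0 := by exact_mod_cast ha.ne'
  refine ⟨atom, hatom, fun f k => ?_, ⟨Samp, hpair, ((2 * R : ℝ) : ℂ)⁻¹ • Synth, ?_⟩,
    ⟨Synth, hsynth, ((2 * R : ℝ) : ℂ)⁻¹ • Samp, ?_⟩, Samp, Synth, fun f => ?_, hpair, hsynth, hid⟩
  · refine (convolutionExistsAt_of_memLp (Lp.memLp f.1) hKq (k / (2 * R))).congr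
      (ae_of_all _ fun x => ?_)
    simp only [ContinuousLinearMap.mul_apply', leftTranslate]
    rw [← hneg, neg_sub]
  · rw [ContinuousLinearMap.smul_comp, hid, inv_smul_smul₀ hne]
  · rw [ContinuousLinearMap.comp_smul, hid, inv_smul_smul₀ hne]
  · exact ⟨conv f K, continuous_conv_bandKernel hΩ hfin hr.ne hKq _, (hfix f).symm, hsamp f⟩
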